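/- Let $A$ be a finite alphabet with at least two letters and $F$ the free group on $A$. An *$A$-generated group* is a group $G$ together with a map $A\to G$ whose image generates $G$; morphisms of $A$-generated groups are the homomorphisms respecting the maps from $A$ (there is at most one between two given $A$-generated groups, it is surjective, and it is denoted $G\twoheadrightarrow H$ and called canonical if it exists; then $H$ is called a quotient of $G$). The product of $A$-generated groups $G$, $H$ is the subgroup of $G\times H$ generated by the pairs $(a,a)$, $a\in A$. A *$PQ$-category* is a nonempty class of finite $A$-generated groups closed under finite products and quotients. For a finite simple group $S$ and an $A$-generated group $G=F/R$ let $R(S)$ be the intersection of all normal subgroups $N$ of $R$ such that $R/N$ is isomorphic to a finite power of $S$, and let $G^{A,S}:=F/R(S)$. For a prime $p$ put $G^{\mathbb{Z}/p}:=G^{A,C_p}$ with $C_p$ cyclic of order $p$ (the Gaschütz extension), and $G^{\widetilde{\mathbb{Z}/p}}:=G^{\mathbb{Z}/p}/Z(G^{\mathbb{Z}/p})$, where $Z$ denotes the centre. A $PQ$-category $\mathfrak{N}$ is *locally extensible* if for every $G=F/R\in\mathfrak{N}$ there is a finite simple group $S$ with $R(S)\neq R$ and $G^{A,S}\in\mathfrak{N}$.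 (The condition $R(S)\ne R$ holds for every finite simple group $S$, because $R$ is free of rank at least $2$ and every finite simple group can be generated by two elements.) **Theorem.** Let $G_0$ be a finite $A$-generated group and let $(p_n)_{n\ge 1}$ be a sequence of pairwise distinct primes none of which divides $|G_0|$. For $n\ge 1$ let $G_n:=G_{n-1}^{\widetilde{\mathbb{Z}/p_n}}$, and let $\mathfrak{N}$ be the class of all quotients of all $G_n$, $n\ge 0$. Then: 1. $\mathfrak{N}$ is a $PQ$-category, and it is not locally extensible. 2. For every $n\ge 0$ the canonical morphism $G_n\twoheadrightarrow G_0$ exists, and for every prime $p$ (dividing $|G_0|$ or not) it does not factor as $G_n\twoheadrightarrow G_0^{\mathbb{Z}/p}\twoheadrightarrow G_0$ through canonical morphisms. 3. For every $n\ge 0$, every abelian quotient of $G_n$ is a quotient of $G_0$. -/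

import Mathlib

universe u

/-- An `A`-generated group: a group together with a map from the alphabet `A` (not necessarily
injective) whose image generates the group. -/
structure AGroup (A : Type u) : Type (u + 1) where
  carrier : Type u
  [group : Group carrier]
  gen : A → carrier
  closure_gen : Subgroup.closure (Set.range gen) = ⊤

namespace AGroup

variable {A : Type u}

instance : CoeSort (AGroup A) (Type u) := ⟨carrier⟩

instance (G : AGroup A) : Group G := G.group

/-- A morphism of `A`-generated groups: a group homomorphism respecting the generators. There is at
most one between two given `A`-generated groups, and it is surjective; so `Nonempty (G.Hom H)`
says that the canonical morphism from `G` onto `H` exists, that is, `H` is a quotient of `G`. -/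
def Hom (G H : AGroup A) : Type u :=
  {f : G →* H // ∀ a, f (G.gen a) = H.gen a}

/-- The kernel `R` of the canonical morphism from the free group on `A` onto `G`. -/
def relators (G : AGroup A) : Subgroup (FreeGroup A) :=
  (FreeGroup.lift G.gen).ker

instance (G : AGroup A) : G.relators.Normal := by
  unfold relators; infer_instance

/-- The quotient of an `A`-generated group by a normal subgroup. -/
def quotient (G : AGroup A) (N : Subgroup G) [N.Normal] : AGroup A where
  carrier := G ⧸ N
  gen a := QuotientGroup.mk' N (G.gen a)
  closure_gen := by
    have h : Set.range (fun a => QuotientGroup.mk' N (G.gen a)) =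
        QuotientGroup.mk' N '' Set.range G.gen := by
      rw [← Set.range_comp]; rfl
    rw [h, ← MonoidHom.map_closure, G.closure_gen, ← MonoidHom.range_eq_map,
      MonoidHom.range_eq_top]
    exact QuotientGroup.mk'_surjective N

/-- The free group on `A` as an `A`-generated group. -/
def free (A : Type u) : AGroup A where
  carrier := FreeGroup A
  gen := FreeGroup.of
  closure_gen := FreeGroup.closure_range_of A

/-- The product of two `A`-generated groups: the subgroup of the direct product generated by the
pairs `(a, a)`. -/
def prod (G H : AGroup A) : AGroup A where
  carrier := Subgroup.closure (Set.range fun a => (G.gen a, H.gen a))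
  gen a := ⟨(G.gen a, H.gen a), Subgroup.subset_closure ⟨a, rfl⟩⟩
  closure_gen := by
    rw [← Subgroup.closure_closure_coe_preimage]
    congr 1
    ext x
    simp [Subtype.ext_iff]

end AGroup

/-- `R(S)`: the intersection of all normal subgroups `N` of `R` for which `R / N` is isomorphic to a
finite power of `S`, i.e. of all kernels of surjective homomorphisms from `R` to some `S ^ k`. -/
def powerResidual (R : Type*) [Group R] (S : Type*) [Group S] : Subgroup R :=
  sInf {N | ∃ (k : ℕ) (f : R →* (Fin k → S)), Function.Surjective f ∧ N = f.ker}

instance powerResidual_characteristic (R : Type*) [Group R] (S : Type*) [Group S] :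
    (powerResidual R S).Characteristic := by
  rw [Subgroup.characteristic_iff_le_comap]
  intro φ x hx
  simp only [powerResidual, Subgroup.mem_comap, Subgroup.mem_sInf, Set.mem_ofPred_eq] at hx ⊢
  rintro N ⟨k, f, hf, rfl⟩
  have := hx (f.comp φ.toMonoidHom).ker ⟨k, _, by simpa using hf, rfl⟩
  exact this

namespace AGroup

variable {A : Type u}

/-- `R(S)` for `R` the kernel of the canonical morphism `F ↠ G`, as a subgroup of `F`. -/
def extRelators (G : AGroup A) (S : Type) [Group S] : Subgroup (AGroup.free A) :=
  (powerResidual G.relators S).map G.relators.subtype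

instance (G : AGroup A) (S : Type) [Group S] : (G.extRelators S).Normal :=
  ConjAct.normal_of_characteristic_of_normal (G := FreeGroup A) (H := G.relators)

/-- The universal `S`-extension `F / R(S)` of `G = F / R`. -/
def universalExt (G : AGroup A) (S : Type) [Group S] : AGroup A :=
  (AGroup.free A).quotient (G.extRelators S)

/-- The Gaschütz extension of `G` for the prime `p`: the universal `S`-extension for `S` cyclic of
order `p`. -/
def gaschutz (G : AGroup A) (p : ℕ) : AGroup A :=
  G.universalExt (Multiplicative (ZMod p))

/-- The Gaschütz extension modulo its centre. -/
def gaschutzModCenter (G : AGroup A) (p : ℕ) : AGroup A :=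
  (G.gaschutz p).quotient (Subgroup.center (G.gaschutz p))

/-- The sequence `G₀ = G` and `Gₙ₊₁ =` the Gaschütz extension of `Gₙ` for `p n`, modulo its
centre. -/
def iterate (G : AGroup A) (p : ℕ → ℕ) : ℕ → AGroup A
  | 0 => G
  | n + 1 => (iterate G p n).gaschutzModCenter (p n)

end AGroup

/-- A class of finite `A`-generated groups which is closed under quotients (in particular under
isomorphism) and under finite products, where the empty product is the trivial group. -/
structure IsPQCategory {A : Type u} (N : Set (AGroup A)) : Prop where
  finite : ∀ G ∈ N, Finite G
  nonempty : N.Nonempty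
  quotient : ∀ G ∈ N, ∀ H : AGroup A, Nonempty (G.Hom H) → H ∈ N
  prod : ∀ G ∈ N, ∀ H ∈ N, G.prod H ∈ N

/-- The class generated by a sequence: all quotients of all members of the sequence. -/
def generatedBy {A : Type u} (G : ℕ → AGroup A) : Set (AGroup A) :=
  {H | ∃ n, Nonempty ((G n).Hom H)}

/-- Local extensibility: every `G = F / R` in `N` has, for some finite simple group `S`, its universal
`S`-extension in `N`. The extension is required to be proper, `R(S) ≠ R`; if `A` has at least two
elements this holds for every finite simple group `S`, because `R` is free of rank at least two
and every finite simple group can be generated by two elements. -/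
def IsLocallyExtensible {A : Type u} (N : Set (AGroup A)) : Prop :=
  ∀ G ∈ N, ∃ (S : Type) (_ : Group S), Finite S ∧ IsSimpleGroup S ∧
    powerResidual G.relators S ≠ ⊤ ∧ G.universalExt S ∈ N

/-! Let `R_n` be the relators of `G_n` in the free group `F`; canonical morphisms are inclusions
between such subgroups. As long as `p n` does not divide `|G_n|`, two things hold. The centre of the
Gaschütz extension of `G_n` lies over the identity of `G_n`, so `R_{n+1} ≤ R_n`
(`relators_gaschutzModCenter_le`, tested in wreath products `C_p ≀ G_n`). And the norm over `G_n` of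
any `r ∈ R_n` is central, hence dies in `G_{n+1}`; in an abelian quotient it equals `r ^ |G_n|`, and
`r ^ p n` dies too, so no abelian quotient is gained (`relators_le_ker_of_gaschutzModCenter`).

The group `R_0 / R_n` is solvable, of exponent dividing the product of the primes used. So
distinctness of the primes preserves the nondivisibility.

The Gaschütz extension of `G_0` for `q` is never a quotient of `G_n`
(`not_relators_iterate_le_gaschutz`). If `q` has been used, its quotient `C_q` would be a quotient
of `G_0`, whose order is prime to `q`. Otherwise a nontrivial character `R_0 → C_q` would factor
through a group of exponent prime to `q`. For a general simple `S`, solvability of `R_0 / R_n`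
forces `S` to be some `C_q`. -/

/-! ### Residuals for simple groups and characters of prime order -/

section PowerResidual

variable {R : Type*} [Group R]

theorem powerResidual_le_ker_of_surjective {S : Type*} [Group S] (f : R →* S)
    (hf : Function.Surjective f) : powerResidual R S ≤ f.ker := by
  intro x hx
  have hsurj : Function.Surjective (MonoidHom.pi fun _ : Fin 1 => f) := by
    intro v
    obtain ⟨r, hr⟩ := hf (v 0)
    exact ⟨r, funext fun i => by rw [Subsingleton.elim i 0, ← hr]; rfl⟩
  have h := (Subgroup.mem_sInf.1 hx) _ ⟨1, _, hsurj, rfl⟩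
  exact congrFun (MonoidHom.mem_ker.1 h) 0

theorem exists_surjective_of_powerResidual_ne_top {S : Type*} [Group S]
    (h : powerResidual R S ≠ ⊤) : ∃ f : R →* S, Function.Surjective f := by
  by_contra hno
  push Not at hno
  refine h (eq_top_iff.2 fun x _ => Subgroup.mem_sInf.2 ?_)
  rintro _ ⟨k, f, hf, rfl⟩
  refine MonoidHom.mem_ker.2 (funext fun i => ?_)
  exact absurd ((Function.surjective_eval i).comp hf)
    (hno ((Pi.evalMonoidHom (fun _ : Fin k => S) i).comp f))

theorem MonoidHom.surjective_of_ne_one_of_prime {p : ℕ} (hp : p.Prime)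
    (f : R →* Multiplicative (ZMod p)) {x : R} (hx : f x ≠ 1) : Function.Surjective f := by
  have := Fact.mk hp
  have hcard : (Nat.card (Multiplicative (ZMod p))).Prime := by simpa using hp
  have := Fact.mk hcard
  rw [← MonoidHom.range_eq_top]
  refine (Subgroup.eq_bot_or_eq_top_of_prime_card f.range).resolve_left fun h => hx ?_
  have : f x ∈ f.range := ⟨x, rfl⟩
  rwa [h, Subgroup.mem_bot] at this

/-- A nontrivial character into a group of prime order is onto, and a map to a power is a tuple of
characters, so surjectivity can be dropped. -/
theorem mem_powerResidual_zmod {p : ℕ} (hp : p.Prime) {x : R} :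
    x ∈ powerResidual R (Multiplicative (ZMod p)) ↔
      ∀ f : R →* Multiplicative (ZMod p), f x = 1 := by
  constructor
  · intro hx f
    by_contra h
    exact h (powerResidual_le_ker_of_surjective f
      (f.surjective_of_ne_one_of_prime hp h) hx)
  · intro h
    refine Subgroup.mem_sInf.2 ?_
    rintro _ ⟨k, f, -, rfl⟩
    exact MonoidHom.mem_ker.2 (funext fun i =>
      h ((Pi.evalMonoidHom (fun _ : Fin k => Multiplicative (ZMod p)) i).comp f))

theorem powerResidual_congr {S T : Type*} [Group S] [Group T] (e : S ≃* T) :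
    powerResidual R S ≤ powerResidual R T := by
  intro x hx
  refine Subgroup.mem_sInf.2 ?_
  rintro _ ⟨k, f, hf, rfl⟩
  have hsurj : Function.Surjective
      ((MonoidHom.pi fun i : Fin k => e.symm.toMonoidHom.comp
        ((Pi.evalMonoidHom (fun _ : Fin k => T) i).comp f))) := by
    intro v
    obtain ⟨r, hr⟩ := hf fun i => e (v i)
    exact ⟨r, funext fun i => by simp [hr]⟩
  have h := Subgroup.mem_sInf.1 hx _ ⟨k, _, hsurj, rfl⟩
  refine MonoidHom.mem_ker.2 (funext fun i => ?_)
  have hi := congrFun (MonoidHom.mem_ker.1 h) i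
  simpa using hi

theorem pow_mem_powerResidual_zmod {p : ℕ} (hp : p.Prime) (x : R) :
    x ^ p ∈ powerResidual R (Multiplicative (ZMod p)) := by
  rw [mem_powerResidual_zmod hp]
  intro f
  rw [map_pow]
  have h := pow_card_eq_one' (x := f x)
  rwa [Nat.card_congr (Multiplicative.toAdd (α := ZMod p)), Nat.card_zmod] at h

theorem commutator_mem_powerResidual_zmod {p : ℕ} (hp : p.Prime) (x y : R) :
    x * y * x⁻¹ * y⁻¹ ∈ powerResidual R (Multiplicative (ZMod p)) := by
  rw [mem_powerResidual_zmod hp]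
  intro f
  simp

theorem finiteIndex_powerResidual_zmod [Group.FG R] {p : ℕ} (hp : p.Prime) :
    (powerResidual R (Multiplicative (ZMod p))).FiniteIndex := by
  have := Fact.mk hp
  obtain ⟨s, hs⟩ := Group.FG.out (G := R)
  have : Finite (R →* Multiplicative (ZMod p)) := by
    refine Finite.of_injective (fun f => fun x : s => f x) fun f g hfg => ?_
    exact MonoidHom.eq_of_eqOn_dense hs fun x hx => congrFun hfg ⟨x, hx⟩
  have h : powerResidual R (Multiplicative (ZMod p)) =
      (MonoidHom.pi fun f : R →* Multiplicative (ZMod p) => f).ker := by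
    ext x
    rw [mem_powerResidual_zmod hp, MonoidHom.mem_ker, funext_iff]
    rfl
  rw [h]
  exact Subgroup.finiteIndex_ker _

end PowerResidual

/-! ### Canonical morphisms and extensions in terms of relators -/

namespace AGroup

variable {A : Type u}

theorem lift_gen_surjective (G : AGroup A) : Function.Surjective (FreeGroup.lift G.gen) := by
  rw [← MonoidHom.range_eq_top, FreeGroup.range_lift_eq_closure, G.closure_gen]

theorem mem_relators (G : AGroup A) {w : FreeGroup A} :
    w ∈ G.relators ↔ FreeGroup.lift G.gen w = 1 := MonoidHom.mem_ker

theorem Hom.comp_lift {G H : AGroup A} (f : G.Hom H) :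
    f.1.comp (FreeGroup.lift G.gen) = FreeGroup.lift H.gen := by
  ext a
  simp [f.2]

theorem Hom.apply_lift {G H : AGroup A} (f : G.Hom H) (w : FreeGroup A) :
    f.1 (FreeGroup.lift G.gen w) = FreeGroup.lift H.gen w :=
  DFunLike.congr_fun f.comp_lift w

theorem nonempty_hom_iff {G H : AGroup A} : Nonempty (G.Hom H) ↔ G.relators ≤ H.relators := by
  constructor
  · rintro ⟨f⟩ w hw
    rw [mem_relators] at hw ⊢
    rw [← f.apply_lift, hw, map_one]
  · intro h
    refine ⟨⟨MonoidHom.liftOfSurjective (FreeGroup.lift G.gen) G.lift_gen_surjective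
      ⟨FreeGroup.lift H.gen, h⟩, fun a => ?_⟩⟩
    have := MonoidHom.liftOfRightInverse_comp_apply (FreeGroup.lift G.gen)
      (Function.surjInv G.lift_gen_surjective)
      (Function.rightInverse_surjInv G.lift_gen_surjective)
      ⟨FreeGroup.lift H.gen, h⟩ (FreeGroup.of a)
    simpa using this

theorem lift_gen_quotient (G : AGroup A) (N : Subgroup G) [N.Normal] (w : FreeGroup A) :
    FreeGroup.lift (G.quotient N).gen w = QuotientGroup.mk' N (FreeGroup.lift G.gen w) := by
  let f : G.Hom (G.quotient N) := ⟨QuotientGroup.mk' N, fun _ => rfl⟩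
  exact (f.apply_lift w).symm

theorem mem_relators_quotient (G : AGroup A) (N : Subgroup G) [N.Normal] {w : FreeGroup A} :
    w ∈ (G.quotient N).relators ↔ FreeGroup.lift G.gen w ∈ N := by
  rw [mem_relators, lift_gen_quotient]
  exact QuotientGroup.eq_one_iff _

theorem lift_gen_free (w : FreeGroup A) : FreeGroup.lift (free A).gen w = w :=
  FreeGroup.lift_of_apply w

theorem relators_universalExt (G : AGroup A) (S : Type) [Group S] :
    (G.universalExt S).relators = (powerResidual G.relators S).map G.relators.subtype := by
  ext w
  unfold universalExt
  rw [mem_relators_quotient, lift_gen_free]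
  rfl

theorem mem_relators_universalExt {G : AGroup A} {S : Type} [Group S] {w : FreeGroup A} :
    w ∈ (G.universalExt S).relators ↔
      ∃ h : w ∈ G.relators, (⟨w, h⟩ : G.relators) ∈ powerResidual G.relators S := by
  rw [relators_universalExt]
  constructor
  · rintro ⟨⟨x, hx⟩, hr, rfl⟩
    exact ⟨hx, hr⟩
  · rintro ⟨h, hr⟩
    exact ⟨⟨w, h⟩, hr, rfl⟩

theorem relators_universalExt_le (G : AGroup A) (S : Type) [Group S] :
    (G.universalExt S).relators ≤ G.relators :=
  fun _ hw => (mem_relators_universalExt.1 hw).1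

theorem mem_relators_gaschutz {G : AGroup A} {p : ℕ} (hp : p.Prime) {w : FreeGroup A} :
    w ∈ (G.gaschutz p).relators ↔
      ∃ h : w ∈ G.relators, ∀ f : G.relators →* Multiplicative (ZMod p), f ⟨w, h⟩ = 1 := by
  unfold gaschutz
  rw [mem_relators_universalExt]
  exact exists_congr fun h => mem_powerResidual_zmod hp

theorem mem_relators_gaschutzModCenter {G : AGroup A} {p : ℕ} {w : FreeGroup A} :
    w ∈ (G.gaschutzModCenter p).relators ↔
      ∀ t : FreeGroup A, w * t * w⁻¹ * t⁻¹ ∈ (G.gaschutz p).relators := by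
  unfold gaschutzModCenter
  rw [mem_relators_quotient, Subgroup.mem_center_iff,
    (G.gaschutz p).lift_gen_surjective.forall]
  refine forall_congr' fun t => ?_
  rw [mem_relators, map_mul, map_mul, map_mul, map_inv, map_inv, mul_inv_eq_one,
    mul_inv_eq_iff_eq_mul, eq_comm]

theorem relators_gaschutz_le_gaschutzModCenter (G : AGroup A) (p : ℕ) :
    (G.gaschutz p).relators ≤ (G.gaschutzModCenter p).relators := by
  intro w hw
  unfold gaschutzModCenter
  rw [mem_relators_quotient, (mem_relators _).1 hw]
  exact one_mem _

theorem pow_mem_relators_gaschutz {G : AGroup A} {p : ℕ} (hp : p.Prime) {w : FreeGroup A}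
    (hw : w ∈ G.relators) : w ^ p ∈ (G.gaschutz p).relators := by
  unfold gaschutz
  rw [mem_relators_universalExt]
  exact ⟨pow_mem hw p, pow_mem_powerResidual_zmod (R := G.relators) hp ⟨w, hw⟩⟩

theorem commutator_mem_relators_gaschutz {G : AGroup A} {p : ℕ} (hp : p.Prime)
    {v w : FreeGroup A} (hv : v ∈ G.relators) (hw : w ∈ G.relators) :
    v * w * v⁻¹ * w⁻¹ ∈ (G.gaschutz p).relators := by
  unfold gaschutz
  rw [mem_relators_universalExt]
  exact ⟨mul_mem (mul_mem (mul_mem hv hw) (inv_mem hv)) (inv_mem hw),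
    commutator_mem_powerResidual_zmod (R := G.relators) hp ⟨v, hv⟩ ⟨w, hw⟩⟩

theorem finite_iff_finiteIndex_relators (G : AGroup A) :
    Finite G ↔ G.relators.FiniteIndex := by
  have e := QuotientGroup.quotientKerEquivOfSurjective _ G.lift_gen_surjective
  exact (Equiv.finite_iff e.toEquiv).symm.trans Subgroup.finiteIndex_iff_finite_quotient.symm

theorem finite_gaschutz [Finite A] (G : AGroup A) [Finite G] {p : ℕ} (hp : p.Prime) :
    Finite (G.gaschutz p) := by
  have hG := G.finite_iff_finiteIndex_relators.1 inferInstance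
  rw [finite_iff_finiteIndex_relators]
  unfold gaschutz
  rw [relators_universalExt]
  have : Group.FG (FreeGroup A) := inferInstance
  have : Group.FG G.relators := inferInstance
  have hR := finiteIndex_powerResidual_zmod (R := G.relators) hp
  refine ⟨?_⟩
  rw [Subgroup.index_map_subtype]
  exact mul_ne_zero hR.index_ne_zero hG.index_ne_zero

theorem finite_gaschutzModCenter [Finite A] (G : AGroup A) [Finite G] {p : ℕ} (hp : p.Prime) :
    Finite (G.gaschutzModCenter p) := by
  have := G.finite_gaschutz hp
  exact Quotient.finite _

end AGroup

/-! ### Wreath products and the centre of the Gaschütz extension -/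

/-- A nontrivial central element cannot act on functions `G → ZMod p` in the way in which a central
lift in a wreath product would have to. -/
theorem eq_one_of_forall_exists_cocycle {A G : Type*} [Group G] [Finite G] {p : ℕ}
    (hp : p.Prime) (hpG : ¬ p ∣ Nat.card G) (γ : A → G) {b c : A} (hbc : b ≠ c) (g : G)
    (hg : ∀ a, Commute g (γ a))
    (H : ∀ v : A → G → ZMod p, ∃ u : G → ZMod p, ∀ a h,
      u h + v a (g⁻¹ * h) = v a h + u ((γ a)⁻¹ * h)) : g = 1 := by
  classical
  have := Fact.mk hp
  have := Fintype.ofFinite G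
  let δ : A → A → G → ZMod p := fun a₀ a h => if a = a₀ ∧ h = 1 then 1 else 0
  -- Take `v` to be a delta at letter `c` and sum the identity for `c` over `⟨γ c⟩`: the `u`-terms
  -- cancel, leaving `0 = 1` unless `g ∈ ⟨γ c⟩`.
  have mem_zpowers : g ∈ Subgroup.zpowers (γ c) := by
    by_contra hg
    obtain ⟨u, hu⟩ := H (δ c)
    let z : Subgroup.zpowers (γ c) := ⟨γ c, Subgroup.mem_zpowers _⟩
    have hsum := Fintype.sum_congr (fun h : Subgroup.zpowers (γ c) => _) _ fun h => hu c h.1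
    rw [Finset.sum_add_distrib, Finset.sum_add_distrib, add_comm] at hsum
    have hshift : ∑ h : Subgroup.zpowers (γ c), u ((γ c)⁻¹ * h.1) =
        ∑ h : Subgroup.zpowers (γ c), u h.1 :=
      Equiv.sum_comp (Equiv.mulLeft z⁻¹) fun h : Subgroup.zpowers (γ c) => u h.1
    rw [hshift, add_left_inj] at hsum
    have h0 : ∑ h : Subgroup.zpowers (γ c), δ c c (g⁻¹ * h.1) = 0 := by
      refine Finset.sum_eq_zero fun h _ => if_neg ?_
      rintro ⟨-, h1⟩
      rw [inv_mul_eq_one] at h1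
      exact hg (h1 ▸ h.2)
    have h1 : ∑ h : Subgroup.zpowers (γ c), δ c c h.1 = 1 := by
      rw [Finset.sum_eq_single 1]
      · simp [δ]
      · intro h _ hne
        exact if_neg fun hh => hne (Subtype.ext hh.2)
      · simp
    rw [h0, h1] at hsum
    exact zero_ne_one hsum
  -- With the delta at `b`, letter `c` makes `u` invariant under `γ c`, hence under its power `g`.
  obtain ⟨u, hu⟩ := H (δ b)
  have hc : ∀ h, u ((γ c)⁻¹ * h) = u h := fun h => by
    have := hu c h
    simpa [δ, hbc, hbc.symm, eq_comm] using this
  have hinv : ∀ h, u (g⁻¹ * h) = u h := by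
    have : ∀ k : ℕ, ∀ h, u (((γ c)⁻¹) ^ k * h) = u h := by
      intro k
      induction k with
      | zero => simp
      | succ k ih => intro h; rw [pow_succ', mul_assoc, hc, ih]
    obtain ⟨k, hk⟩ := (mem_powers_iff_mem_zpowers (x := γ c)).2 mem_zpowers
    intro h
    rw [← hk]
    simpa using this k h
  by_contra hne
  -- If `g ≠ 1`, letter `b` at `1` and at `g⁻¹` gives `1 + [g² = 1] = 0` in `ZMod p`. This leaves
  -- only `p = 2` with `g` of order two, the one place where `hpG` is needed.
  have e₁ := hu b 1
  have e₂ := hu b g⁻¹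
  have hswap : (γ b)⁻¹ * g⁻¹ = g⁻¹ * (γ b)⁻¹ := (hg b).inv_inv.eq.symm
  have hu1 : u g⁻¹ = u 1 := by simpa using hinv 1
  rw [hswap, hinv, hu1] at e₂
  simp only [δ, mul_one, inv_eq_one, hne, and_false, if_false, true_and, if_true,
    add_zero, zero_add] at e₁ e₂
  rw [← e₂] at e₁
  by_cases hsq : g⁻¹ * g⁻¹ = 1
  · rw [if_pos hsq] at e₁
    have h2 : ((2 : ℕ) : ZMod p) = 0 := by
      push_cast
      linear_combination -e₁
    rw [ZMod.natCast_eq_zero_iff] at h2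
    refine hpG (h2.trans ?_)
    have hord : orderOf g = 2 := orderOf_eq_prime (by
      rw [pow_two, ← inv_inj, mul_inv_rev, hsq, inv_one]) hne
    exact hord ▸ orderOf_dvd_natCard g
  · rw [if_neg hsq] at e₁
    exact one_ne_zero (α := ZMod p) (by linear_combination -e₁)

/-- The homomorphism from the free group to the regular wreath product given by `v` on the base and
by `G.gen` on the top. -/
def AGroup.wreathLift {A : Type u} (G : AGroup A) {D : Type*} [Group D] (v : A → G → D) :
    FreeGroup A →* D ≀ᵣ G :=
  FreeGroup.lift fun a => ⟨v a, G.gen a⟩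

namespace AGroup

variable {A : Type u}

theorem wreathLift_right (G : AGroup A) {D : Type*} [Group D] (v : A → G → D)
    (w : FreeGroup A) : (G.wreathLift v w).right = FreeGroup.lift G.gen w := by
  have : RegularWreathProduct.rightHom.comp (G.wreathLift v) = FreeGroup.lift G.gen := by
    ext a
    simp [wreathLift]
  exact DFunLike.congr_fun this w

/-- Evaluation of the base part of `wreathLift` on the relators of `G`. -/
def wreathCoord (G : AGroup A) {D : Type*} [Group D] (v : A → G → D) (h : G) :
    G.relators →* D where
  toFun r := (G.wreathLift v r).left h
  map_one' := by simp
  map_mul' r s := by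
    have hr : (G.wreathLift v r).right = 1 := by
      rw [wreathLift_right]
      exact r.2
    simp [hr]

/-- On relators of `G` the top part is trivial and each base coordinate is a character to `C_p`,
which kills the Gaschütz relators. -/
theorem wreathLift_eq_one_of_mem_relators_gaschutz {G : AGroup A} {p : ℕ} (hp : p.Prime)
    (v : A → G → Multiplicative (ZMod p)) {w : FreeGroup A}
    (hw : w ∈ (G.gaschutz p).relators) : G.wreathLift v w = 1 := by
  obtain ⟨hR, hf⟩ := (mem_relators_gaschutz hp).1 hw
  refine RegularWreathProduct.ext (funext fun h => hf (G.wreathCoord v h)) ?_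
  rw [wreathLift_right]
  exact hR

/-- For `p` prime to the order of `G`, the centre of the Gaschütz extension lies in the kernel of
its canonical morphism onto `G`. -/
theorem relators_gaschutzModCenter_le [Nontrivial A] (G : AGroup A) [Finite G] {p : ℕ}
    (hp : p.Prime) (hpG : ¬ p ∣ Nat.card G) :
    (G.gaschutzModCenter p).relators ≤ G.relators := by
  intro w hw
  rw [mem_relators_gaschutzModCenter] at hw
  obtain ⟨b, c, hbc⟩ := exists_pair_ne A
  rw [mem_relators]
  refine eq_one_of_forall_exists_cocycle hp hpG G.gen hbc _ (fun a => ?_) fun v => ?_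
  · have h := relators_universalExt_le G _ (hw (FreeGroup.of a))
    rw [mem_relators, map_mul, map_mul, map_mul, map_inv, map_inv, mul_inv_eq_one,
      mul_inv_eq_iff_eq_mul, FreeGroup.lift_apply_of] at h
    exact h
  · let v' : A → G → Multiplicative (ZMod p) := fun a h => Multiplicative.ofAdd (v a h)
    refine ⟨fun h => Multiplicative.toAdd ((G.wreathLift v' w).left h), fun a h => ?_⟩
    have hcomm := wreathLift_eq_one_of_mem_relators_gaschutz hp v' (hw (FreeGroup.of a))
    rw [map_mul, map_mul, map_mul, map_inv, map_inv, mul_inv_eq_one,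
      mul_inv_eq_iff_eq_mul] at hcomm
    have hl := congrFun (congrArg RegularWreathProduct.left hcomm) h
    have ha : G.wreathLift v' (FreeGroup.of a) = ⟨v' a, G.gen a⟩ := by simp [wreathLift]
    rw [ha, RegularWreathProduct.mul_left, RegularWreathProduct.mul_left, wreathLift_right] at hl
    exact congrArg Multiplicative.toAdd hl

/-- For `p` prime to the order of `G`, the Gaschütz extension modulo its centre has no more abelian
quotients than `G`. -/
theorem relators_le_ker_of_gaschutzModCenter {G : AGroup A} [Finite G] {p : ℕ}
    (hp : p.Prime) (hpG : ¬ p ∣ Nat.card G) {H : Type*} [Group H]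
    (hH : ∀ x y : H, x * y = y * x) (f : FreeGroup A →* H)
    (hf : (G.gaschutzModCenter p).relators ≤ f.ker) : G.relators ≤ f.ker := by
  have := Fintype.ofFinite G
  intro r hr
  let s : G → FreeGroup A := Function.surjInv G.lift_gen_surjective
  have hs : ∀ g, FreeGroup.lift G.gen (s g) = g := Function.surjInv_eq G.lift_gen_surjective
  let r' : G.relators := ⟨r, hr⟩
  -- The norm of `r` over `G`, formed with a set-theoretic section `s`; modulo the Gaschütz relators
  -- the choice of `s` and the order of the factors are irrelevant.
  let n : G.relators := (Finset.univ.toList.map fun g : G => MulAut.conjNormal (s g) r').prod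
  have hprod : ∀ χ : G.relators →* Multiplicative (ZMod p),
      χ n = ∏ g : G, χ (MulAut.conjNormal (s g) r') := by
    intro χ
    rw [map_list_prod, List.map_map, ← Finset.prod_map_toList]
    rfl
  have hconj : ∀ (χ : G.relators →* Multiplicative (ZMod p)) (u v : FreeGroup A),
      FreeGroup.lift G.gen u = FreeGroup.lift G.gen v →
      χ (MulAut.conjNormal u r') = χ (MulAut.conjNormal v r') := by
    intro χ u v huv
    have hk : u * v⁻¹ ∈ G.relators := by
      rw [mem_relators, map_mul, map_inv, huv, mul_inv_cancel]
    have : MulAut.conjNormal u r' =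
        (⟨u * v⁻¹, hk⟩ : G.relators) * MulAut.conjNormal v r' * (⟨u * v⁻¹, hk⟩ : G.relators)⁻¹ := by
      ext
      simp [MulAut.conjNormal_apply, mul_assoc]
    rw [this, map_mul, map_mul, map_inv, mul_inv_cancel_comm]
  have hn : (n : FreeGroup A) ∈ (G.gaschutzModCenter p).relators := by
    rw [mem_relators_gaschutzModCenter]
    intro t
    -- Conjugation by `t` only permutes the factors of the norm, so no character distinguishes `n`
    -- from its conjugate.
    have hinv : ∀ χ : G.relators →* Multiplicative (ZMod p),
        χ (MulAut.conjNormal t n) = χ n := by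
      intro χ
      have e := hprod (χ.comp (MulAut.conjNormal t : MulAut G.relators).toMonoidHom)
      refine e.trans ((Fintype.prod_equiv (Equiv.mulLeft (FreeGroup.lift G.gen t)) _ _
        fun g => ?_).trans (hprod χ).symm)
      rw [Equiv.coe_mulLeft, hconj χ (s (FreeGroup.lift G.gen t * g)) (t * s g)
        (by rw [hs, map_mul, hs]), map_mul]
      rfl
    have hmem : ((n * (MulAut.conjNormal t n)⁻¹ : G.relators) : FreeGroup A) =
        n * t * (n : FreeGroup A)⁻¹ * t⁻¹ := by
      simp [MulAut.conjNormal_apply, mul_assoc]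
    rw [← hmem, mem_relators_gaschutz hp]
    exact ⟨Subtype.property _, fun χ => by
      rw [Subtype.coe_eta, map_mul, map_inv, hinv, mul_inv_cancel]⟩
  have hfn : f n = f r ^ Nat.card G := by
    have : f.comp G.relators.subtype n =
        (Finset.univ.toList.map fun g : G =>
          f.comp G.relators.subtype (MulAut.conjNormal (s g) r')).prod := by
      rw [map_list_prod, List.map_map]
      rfl
    refine this.trans ?_
    rw [List.prod_eq_pow_card _ (f r)]
    · simp
    · intro x hx
      obtain ⟨g, -, rfl⟩ := List.mem_map.1 hx
      simp [MulAut.conjNormal_apply, r', hH (f (s g)) (f r)]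
  have h1 : f r ^ Nat.card G = 1 := hfn ▸ hf hn
  have h2 : f r ^ p = 1 := by
    rw [← map_pow]
    exact hf (relators_gaschutz_le_gaschutzModCenter G p (pow_mem_relators_gaschutz hp hr))
  have hco : Nat.Coprime p (Nat.card G) := (hp.coprime_iff_not_dvd).2 hpG
  rw [MonoidHom.mem_ker, ← pow_one (f r), ← hco]
  exact pow_gcd_eq_one.2 ⟨h2, h1⟩

end AGroup

/-! ### Characters of free subgroups and simple quotients -/

/-- `R` is free by Nielsen–Schreier, and nontrivial because `FreeGroup A` is infinite; send every
free generator to `1 : ZMod q`. -/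
theorem FreeGroup.exists_hom_ne_one {A : Type u} [Nonempty A] (R : Subgroup (FreeGroup A))
    [R.FiniteIndex] {q : ℕ} (hq : q.Prime) :
    ∃ (χ : R →* Multiplicative (ZMod q)) (r : R), χ r ≠ 1 := by
  have := Fact.mk hq
  have hR : Nontrivial R := by
    rw [Subgroup.nontrivial_iff_ne_bot]
    rintro rfl
    have h := Subgroup.FiniteIndex.index_ne_zero (H := (⊥ : Subgroup (FreeGroup A)))
    rw [Subgroup.index_bot, Nat.card_eq_zero_of_infinite] at h
    exact h rfl
  let e := IsFreeGroup.toFreeGroup R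
  have hgen : Nonempty (IsFreeGroup.Generators R) := by
    by_contra hempty
    rw [not_nonempty_iff] at hempty
    exact not_subsingleton R e.toEquiv.subsingleton
  obtain ⟨x⟩ := hgen
  refine ⟨(FreeGroup.lift fun _ => Multiplicative.ofAdd 1).comp e.toMonoidHom,
    e.symm (FreeGroup.of x), ?_⟩
  simp

/-- The image of `N` is normal in `S`, hence trivial or all of `S`; in the second case `S` is a
commutative image of `N`. -/
theorem Subgroup.le_ker_or_commutative_of_isSimpleGroup {R S : Type*} [Group R] [Group S]
    [IsSimpleGroup S] (f : R →* S) (hf : Function.Surjective f) (N : Subgroup R) [N.Normal]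
    (h : ∀ x ∈ N, ∀ y ∈ N, f (x * y * x⁻¹ * y⁻¹) = 1) :
    N ≤ f.ker ∨ ∀ a b : S, a * b = b * a := by
  have hnormal : (N.map f).Normal := Subgroup.Normal.map inferInstance f hf
  refine hnormal.eq_bot_or_eq_top.imp (fun hbot => (Subgroup.map_eq_bot_iff _).1 hbot)
    fun htop a b => ?_
  have ha : a ∈ N.map f := htop ▸ Subgroup.mem_top a
  have hb : b ∈ N.map f := htop ▸ Subgroup.mem_top b
  obtain ⟨x, hx, rfl⟩ := ha
  obtain ⟨y, hy, rfl⟩ := hb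
  have hxy := h x hx y hy
  rwa [map_mul, map_mul, map_mul, map_inv, map_inv, mul_inv_eq_one,
    mul_inv_eq_iff_eq_mul] at hxy

namespace AGroup

variable {A : Type u}

theorem universalExt_congr {S T : Type} [Group S] [Group T] (e : S ≃* T) (G : AGroup A) :
    (G.universalExt S).relators ≤ (G.universalExt T).relators := by
  intro w hw
  rw [mem_relators_universalExt] at hw ⊢
  exact hw.imp fun h hr => powerResidual_congr e hr

theorem relators_gaschutz_le_ker (G : AGroup A) {q : ℕ} (hq : q.Prime)
    (f : FreeGroup A →* Multiplicative (ZMod q)) : (G.gaschutz q).relators ≤ f.ker := by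
  intro w hw
  obtain ⟨h, hf⟩ := (mem_relators_gaschutz hq).1 hw
  exact hf (f.comp G.relators.subtype)

theorem inf_relators_le_relators_prod (G H : AGroup A) :
    G.relators ⊓ H.relators ≤ (G.prod H).relators := by
  intro w hw
  let f : (G.prod H).Hom G := ⟨(MonoidHom.fst G H).comp (Subgroup.subtype _), fun _ => rfl⟩
  let g : (G.prod H).Hom H := ⟨(MonoidHom.snd G H).comp (Subgroup.subtype _), fun _ => rfl⟩
  rw [mem_relators]
  exact Subtype.ext (Prod.ext ((f.apply_lift w).trans hw.1) ((g.apply_lift w).trans hw.2))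

/-! ### The iterated sequence -/

variable {G₀ : AGroup A} {p : ℕ → ℕ}

/-- `p n` does not divide the order of `Gₙ`, in terms of an exponent of the kernel of the canonical
morphism onto `G₀`. -/
theorem not_dvd_natCard_of_pow_mem {G : AGroup A} [Finite G] {q m : ℕ} (hq : q.Prime)
    (hG₀ : ¬ q ∣ Nat.card G₀) (hm : q.Coprime m) (hle : G.relators ≤ G₀.relators)
    (hpow : ∀ r ∈ G₀.relators, r ^ m ∈ G.relators) : ¬ q ∣ Nat.card G := by
  intro hdvd
  have := Fact.mk hq
  -- An element of order `q` dies in `G₀`, so it lies in a kernel of exponent prime to `q`.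
  obtain ⟨x, hx⟩ := exists_prime_orderOf_dvd_card' q hdvd
  obtain ⟨w, rfl⟩ := G.lift_gen_surjective x
  have hwq : w ^ q ∈ G.relators := by
    rw [mem_relators, map_pow, ← hx, pow_orderOf_eq_one]
  have hw₀ : w ∈ G₀.relators := by
    have h1 : FreeGroup.lift G₀.gen w ^ q = 1 := by
      rw [← map_pow]
      exact hle hwq
    have hco : Nat.Coprime q (Nat.card G₀) := (hq.coprime_iff_not_dvd).2 hG₀
    rw [mem_relators, ← pow_one (FreeGroup.lift G₀.gen w), ← hco]
    exact pow_gcd_eq_one.2 ⟨h1, pow_card_eq_one'⟩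
  have h1 : FreeGroup.lift G.gen w = 1 := by
    rw [← pow_one (FreeGroup.lift G.gen w), ← hm]
    refine pow_gcd_eq_one.2 ⟨?_, ?_⟩ <;> rw [← map_pow]
    exacts [hwq, hpow w hw₀]
  rw [h1, orderOf_one] at hx
  exact hq.one_lt.ne hx

theorem coprime_prod_range (hp : ∀ n, (p n).Prime) {q : ℕ} (hq : q.Prime) (n : ℕ)
    (hne : ∀ i < n, q ≠ p i) : q.Coprime (∏ i ∈ Finset.range n, p i) :=
  Nat.Coprime.prod_right fun i hi =>
    (Nat.coprime_primes hq (hp i)).2 (hne i (Finset.mem_range.1 hi))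

/-- Each `R_n / R_{n+1} ⊓ R_n` is abelian, so unless `S` is commutative `f` kills `R_n` as soon as
it kills `R_{n+1}`; descending to `R_0` makes `S` trivial. -/
theorem commutative_of_relators_iterate_le_ker (hp : ∀ n, (p n).Prime) {S : Type*} [Group S]
    [IsSimpleGroup S] (f : G₀.relators →* S) (hf : Function.Surjective f) (n : ℕ)
    (h : (G₀.iterate p n).relators.subgroupOf G₀.relators ≤ f.ker) :
    ∀ a b : S, a * b = b * a := by
  induction n with
  | zero =>
    intro a b
    obtain ⟨x, rfl⟩ := hf a
    have hx : f x = 1 := h x.2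
    rw [hx, one_mul, mul_one]
  | succ n ih =>
    refine (Subgroup.le_ker_or_commutative_of_isSimpleGroup f hf
      ((G₀.iterate p n).relators.subgroupOf G₀.relators) fun x hx y hy => ?_).elim ih id
    exact h (relators_gaschutz_le_gaschutzModCenter _ _
      (commutator_mem_relators_gaschutz (hp n) hx hy))

variable [Finite A] [Nontrivial A] [Finite G₀]

/-- The clauses need a joint induction: the inclusion at `n + 1` uses nondivisibility at `n`, which
in turn rests on the inclusion and the exponent. -/
theorem iterate_properties (hp : ∀ n, (p n).Prime) (hinj : Function.Injective p)
    (hG : ∀ n, ¬ p n ∣ Nat.card G₀) (n : ℕ) :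
    Finite (G₀.iterate p n) ∧ (G₀.iterate p n).relators ≤ G₀.relators ∧
      (∀ r ∈ G₀.relators, r ^ (∏ i ∈ Finset.range n, p i) ∈ (G₀.iterate p n).relators) ∧
      ¬ p n ∣ Nat.card (G₀.iterate p n) := by
  induction n with
  | zero => exact ⟨inferInstanceAs (Finite G₀), le_rfl, fun r hr => pow_mem hr _, hG 0⟩
  | succ n ih =>
    obtain ⟨hfin, hle, hpow, hndvd⟩ := ih
    have hfin' : Finite (G₀.iterate p (n + 1)) := finite_gaschutzModCenter _ (hp n)
    have hle' : (G₀.iterate p (n + 1)).relators ≤ G₀.relators :=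
      (relators_gaschutzModCenter_le _ (hp n) hndvd).trans hle
    have hpow' : ∀ r ∈ G₀.relators,
        r ^ (∏ i ∈ Finset.range (n + 1), p i) ∈ (G₀.iterate p (n + 1)).relators := by
      intro r hr
      rw [Finset.prod_range_succ, pow_mul]
      exact relators_gaschutz_le_gaschutzModCenter _ _
        (pow_mem_relators_gaschutz (hp n) (hpow r hr))
    exact ⟨hfin', hle', hpow', not_dvd_natCard_of_pow_mem (hp _) (hG _)
      (coprime_prod_range hp (hp _) _ fun i hi h => hi.ne' (hinj h)) hle' hpow'⟩

theorem antitone_relators_iterate (hp : ∀ n, (p n).Prime) (hinj : Function.Injective p)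
    (hG : ∀ n, ¬ p n ∣ Nat.card G₀) : Antitone fun n => (G₀.iterate p n).relators := by
  refine antitone_nat_of_succ_le fun n => ?_
  obtain ⟨hfin, -, -, hndvd⟩ := iterate_properties hp hinj hG n
  exact relators_gaschutzModCenter_le _ (hp n) hndvd

theorem relators_le_ker_of_iterate (hp : ∀ n, (p n).Prime) (hinj : Function.Injective p)
    (hG : ∀ n, ¬ p n ∣ Nat.card G₀) {H : Type*} [Group H] (hH : ∀ x y : H, x * y = y * x)
    (f : FreeGroup A →* H) (n : ℕ) (hf : (G₀.iterate p n).relators ≤ f.ker) :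
    G₀.relators ≤ f.ker := by
  induction n with
  | zero => exact hf
  | succ n ih =>
    obtain ⟨hfin, -, -, hndvd⟩ := iterate_properties hp hinj hG n
    exact ih (relators_le_ker_of_gaschutzModCenter (hp n) hndvd hH f hf)

theorem not_relators_iterate_le_gaschutz (hp : ∀ n, (p n).Prime) (hinj : Function.Injective p)
    (hG : ∀ n, ¬ p n ∣ Nat.card G₀) (n : ℕ) {q : ℕ} (hq : q.Prime) :
    ¬ (G₀.iterate p n).relators ≤ (G₀.gaschutz q).relators := by
  intro hle
  by_cases hex : ∃ i < n, q = p i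
  · obtain ⟨i, -, rfl⟩ := hex
    -- The character sending every letter to `1` would kill `a ^ |G₀|`, so `p i` would divide
    -- `|G₀|`.
    have h := relators_le_ker_of_iterate hp hinj hG mul_comm
      (FreeGroup.lift fun _ : A => Multiplicative.ofAdd (1 : ZMod (p i))) n
      (hle.trans (relators_gaschutz_le_ker G₀ hq _))
    obtain ⟨a⟩ := (inferInstance : Nonempty A)
    have ha : FreeGroup.of a ^ Nat.card G₀ ∈ G₀.relators := by
      rw [mem_relators, map_pow, pow_card_eq_one']
    have h1 := MonoidHom.mem_ker.1 (h ha)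
    rw [map_pow, FreeGroup.lift_apply_of, ← ofAdd_nsmul, ofAdd_eq_one, nsmul_one,
      ZMod.natCast_eq_zero_iff] at h1
    exact hG i h1
  · push Not at hex
    have := G₀.finite_iff_finiteIndex_relators.1 inferInstance
    obtain ⟨χ, r, hr⟩ := FreeGroup.exists_hom_ne_one G₀.relators hq
    obtain ⟨-, -, hpow, -⟩ := iterate_properties hp hinj hG n
    obtain ⟨_, h1⟩ := (mem_relators_gaschutz hq).1 (hle (hpow r r.2))
    have h2 : χ r ^ (∏ i ∈ Finset.range n, p i) = 1 := by
      rw [← map_pow]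
      exact h1 χ
    have h3 : χ r ^ q = 1 :=
      (mem_powerResidual_zmod hq).1 (pow_mem_powerResidual_zmod hq r) χ ▸ (map_pow χ r q).symm
    refine hr ?_
    rw [← pow_one (χ r), ← coprime_prod_range hp hq n hex]
    exact pow_gcd_eq_one.2 ⟨h3, h2⟩

end AGroup

/-! ### The class generated by the sequence -/

theorem exists_prime_mulEquiv_zmod {S : Type*} [Group S] [Finite S] [IsSimpleGroup S]
    (h : ∀ a b : S, a * b = b * a) :
    ∃ q : ℕ, q.Prime ∧ Nonempty (S ≃* Multiplicative (ZMod q)) := by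
  let _ : CommGroup S := { mul_comm := h }
  have hq : (Nat.card S).Prime := IsSimpleGroup.prime_card
  have := Fact.mk hq
  exact ⟨Nat.card S, hq, ⟨mulEquivOfPrimeCardEq (p := Nat.card S) rfl (by simp)⟩⟩

theorem isPQCategory_generatedBy_iterate {A : Type u} [Finite A] [Nontrivial A] {G₀ : AGroup A}
    [Finite G₀] {p : ℕ → ℕ} (hp : ∀ n, (p n).Prime) (hinj : Function.Injective p)
    (hG : ∀ n, ¬ p n ∣ Nat.card G₀) : IsPQCategory (generatedBy (G₀.iterate p)) where
  finite := by
    rintro H ⟨n, hn⟩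
    rw [AGroup.nonempty_hom_iff] at hn
    have hfin := (AGroup.iterate_properties hp hinj hG n).1
    rw [AGroup.finite_iff_finiteIndex_relators] at hfin ⊢
    exact Subgroup.finiteIndex_of_le hn
  nonempty := ⟨G₀, 0, AGroup.nonempty_hom_iff.2 le_rfl⟩
  quotient := by
    rintro G ⟨n, hn⟩ H hH
    rw [AGroup.nonempty_hom_iff] at hn hH
    exact ⟨n, AGroup.nonempty_hom_iff.2 (hn.trans hH)⟩
  prod := by
    rintro G ⟨m, hm⟩ H ⟨n, hn⟩
    rw [AGroup.nonempty_hom_iff] at hm hn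
    have hanti := AGroup.antitone_relators_iterate hp hinj hG
    refine ⟨max m n, AGroup.nonempty_hom_iff.2 ?_⟩
    exact le_trans (le_inf ((hanti (le_max_left m n)).trans hm)
      ((hanti (le_max_right m n)).trans hn)) (AGroup.inf_relators_le_relators_prod G H)

theorem not_isLocallyExtensible_generatedBy_iterate {A : Type u} [Finite A] [Nontrivial A]
    {G₀ : AGroup A} [Finite G₀] {p : ℕ → ℕ} (hp : ∀ n, (p n).Prime)
    (hinj : Function.Injective p) (hG : ∀ n, ¬ p n ∣ Nat.card G₀) :
    ¬ IsLocallyExtensible (generatedBy (G₀.iterate p)) := by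
  intro hloc
  -- Local extensibility already fails at `G₀` itself.
  obtain ⟨S, _, hfin, hsimple, hne, n, hn⟩ := hloc G₀ ⟨0, AGroup.nonempty_hom_iff.2 le_rfl⟩
  rw [AGroup.nonempty_hom_iff] at hn
  obtain ⟨f, hf⟩ := exists_surjective_of_powerResidual_ne_top hne
  have hker : (G₀.iterate p n).relators.subgroupOf G₀.relators ≤ f.ker := by
    intro r hr
    obtain ⟨_, h⟩ := AGroup.mem_relators_universalExt.1 (hn hr)
    exact powerResidual_le_ker_of_surjective f hf h
  obtain ⟨q, hq, ⟨e⟩⟩ := exists_prime_mulEquiv_zmod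
    (AGroup.commutative_of_relators_iterate_le_ker hp f hf n hker)
  exact AGroup.not_relators_iterate_le_gaschutz hp hinj hG n hq
    (hn.trans (AGroup.universalExt_congr e G₀))

theorem mainTheorem7 {A : Type u} [Finite A] [Nontrivial A] (G₀ : AGroup A) [Finite G₀]
    (p : ℕ → ℕ) (hp : ∀ n, (p n).Prime) (hinj : Function.Injective p)
    (hG : ∀ n, ¬ p n ∣ Nat.card G₀) :
    IsPQCategory (generatedBy (G₀.iterate p)) ∧
    ¬ IsLocallyExtensible (generatedBy (G₀.iterate p)) ∧
    (∀ n, ∃ π : (G₀.iterate p n).Hom G₀, ∀ q : ℕ, q.Prime →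
      ¬ ∃ (f : (G₀.iterate p n).Hom (G₀.gaschutz q)) (g : (G₀.gaschutz q).Hom G₀),
        g.1.comp f.1 = π.1) ∧
    (∀ n, ∀ H : AGroup A, (∀ x y : H, x * y = y * x) →
      Nonempty ((G₀.iterate p n).Hom H) → Nonempty (G₀.Hom H)) := by
  refine ⟨isPQCategory_generatedBy_iterate hp hinj hG,
    not_isLocallyExtensible_generatedBy_iterate hp hinj hG, fun n => ?_, fun n H hH hn => ?_⟩
  · obtain ⟨π⟩ := AGroup.nonempty_hom_iff.2 (AGroup.iterate_properties hp hinj hG n).2.1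
    refine ⟨π, fun q hq => ?_⟩
    rintro ⟨f, -, -⟩
    exact AGroup.not_relators_iterate_le_gaschutz hp hinj hG n hq
      (AGroup.nonempty_hom_iff.1 ⟨f⟩)
  · rw [AGroup.nonempty_hom_iff] at hn ⊢
    exact AGroup.relators_le_ker_of_iterate hp hinj hG hH _ n hn
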